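/- **Forest Identity.** Let $n\ge 2$ and let $a_{ij}$ ($i\ne j$ in $\{0,1,\dots,n\}$) be weights, in an arbitrary commutative semiring, on the edges $i\to j$ of the complete directed graph on the nodes $\{0,1,\dots,n\}$. For a set $U$ of nodes, let $R_U$ be the set of directed rooted forests on all the nodes $\{0,1,\dots,n\}$ whose set of roots is exactly $U$: the nodes of $U$ have no out-edge, every other node has exactly one out-edge, and from every node there is a directed path to a node of $U$. Let $R_U^{i\to j}\subseteq R_U$ be the set of those forests that have a meta-edge $i\to j$, that is, a directed path from $i$ to $j$. The weight $a_F$ of a forest $F$ is the product of the weights $a_{ij}$ of all edges $i\to j$ in $F$. Let $$R^{NF}=\bigl(R_{\{0,2\}}\times R_{\{0,1\}}\bigr)\setminus\bigl(R_{\{0,2\}}^{1\to 2}\times R_{\{0,1\}}^{2\to 1}\bigr)$$ be the set of non-forbidden pairs. Then $$\sum_{(F,G)\in R_{\{0\}}\times R_{\{0,1,2\}}}a_Fa_G=\sum_{(F,G)\in R^{NF}}a_Fa_G.$$ -/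

import Mathlib

namespace ForestIdentity

variable {V : Type*}

/-- A directed graph on the node set `V` is given by its finite set of edges; `(i, j) ∈ F` is the
edge `i → j`. `MetaEdge F i j` says that `F` contains a directed path from `i` to `j`. -/
def MetaEdge (F : Finset (V × V)) (i j : V) : Prop :=
  Relation.ReflTransGen (fun x y => (x, y) ∈ F) i j

/-- `F` is a directed rooted forest on `V` whose set of roots is exactly `U`: every node has at most
one out-edge, the roots are exactly the nodes without out-edge, and every node is joined to a
root by a directed path. (So there are no cycles; in particular no loop `(i, i)` is in `F`.) -/
structure IsRootedForest (F : Finset (V × V)) (U : Finset V) : Prop where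
  out_unique : ∀ i j k, (i, j) ∈ F → (i, k) ∈ F → j = k
  mem_roots_iff : ∀ i, i ∈ U ↔ ∀ j, (i, j) ∉ F
  exists_path_to_root : ∀ i, ∃ r ∈ U, MetaEdge F i r

open Classical in
/-- The set `R_U` of the forests on `V` with set of roots `U`. -/
noncomputable def rootedForests [Fintype V] (U : Finset V) : Finset (Finset (V × V)) :=
  Finset.univ.filter fun F => IsRootedForest F U

open Classical in
/-- The set `R_U^{i → j}` of the forests with set of roots `U` that have a meta-edge `i → j`. -/
noncomputable def rootedForestsWithMetaEdge [Fintype V] (U : Finset V) (i j : V) :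
    Finset (Finset (V × V)) :=
  (rootedForests U).filter fun F => MetaEdge F i j

/-- The weight `a_F`, the product of the weights `a i j` of the edges `i → j` of `F`. -/
def weight {R : Type*} [CommSemiring R] (a : V → V → R) (F : Finset (V × V)) : R :=
  ∏ e ∈ F, a e.1 e.2

/-- The set `R^{NF}` of non-forbidden pairs of two-forests on the nodes `0, …, n`. -/
noncomputable def nonForbiddenPairs (n : ℕ) :
    Finset (Finset (Fin (n + 1) × Fin (n + 1)) × Finset (Fin (n + 1) × Fin (n + 1))) :=
  (rootedForests {0, 2} ×ˢ rootedForests {0, 1}) \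
    (rootedForestsWithMetaEdge {0, 2} 1 2 ×ˢ rootedForestsWithMetaEdge {0, 1} 2 1)

end ForestIdentity

/-! For positive real weights, the forests with roots `U` and a path `k → u`, divided by all forests
with roots `U`, give the probability that the random walk from `k` with rates `a` enters `U` at `u`.
Accordingly these forest sums are harmonic in `k` off `U` (`forestSumWithMetaEdge_harmonic`). The
maximum principle makes harmonic functions unique, whence a strong Markov identity
(`forestSumWithMetaEdge_mul_forestSum`): a walk from `j` that reaches `s` before `r` either enters
`{r, s, t}` at `s`, or enters at `t` and goes on from there to `s`. Expanding along the out-edge of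
`s` turns the forest identity into a weighted sum of Markov identities over `j`. Once moved to the
side without subtraction, it is an identity of polynomials over `ℕ`, so positive real weights
suffice for every commutative semiring. -/

namespace ForestIdentity

/-! ### Adding and removing one edge of a forest -/

section Forests

variable {V : Type*} {F G : Finset (V × V)} {U : Finset V} {i j k l r u v x : V}

theorem MetaEdge.mono (h : F ⊆ G) (hF : MetaEdge F i j) : MetaEdge G i j :=
  Relation.ReflTransGen.mono (fun _ _ hxy => h hxy) _ _ hF

theorem IsRootedForest.eq_of_metaEdge_root (hF : IsRootedForest F U) (hr : r ∈ U)
    (h : MetaEdge F r x) : r = x := by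
  rcases Relation.ReflTransGen.cases_head h with h | ⟨c, hc, -⟩
  · exact h
  · exact absurd hc ((hF.mem_roots_iff r).1 hr c)

theorem IsRootedForest.root_unique (hF : IsRootedForest F U) (hu : u ∈ U) (hv : v ∈ U)
    (h : MetaEdge F x u) (h' : MetaEdge F x v) : u = v := by
  have hR : Relator.RightUnique (fun x y => (x, y) ∈ F) :=
    fun a b c hab hac => hF.out_unique a b c hab hac
  rcases Relation.ReflTransGen.total_of_right_unique hR h h' with h | h
  · exact hF.eq_of_metaEdge_root hu h
  · exact (hF.eq_of_metaEdge_root hv h).symm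

theorem IsRootedForest.not_metaEdge_of_edge (hF : IsRootedForest F U) (hjl : (j, l) ∈ F) :
    ¬ MetaEdge F l j := by
  intro hlj
  obtain ⟨r, hr, hjr⟩ := hF.exists_path_to_root j
  -- On a cycle through `j`, unique out-edges force everything reachable from `j` to lead back to
  -- `j`; this applies to the root of `j`.
  have key : MetaEdge F r j := by
    clear hr
    induction hjr with
    | refl => exact .refl
    | tail _ hxy ih =>
      rcases Relation.ReflTransGen.cases_head ih with rfl | ⟨c, hc, hcj⟩
      · exact hF.out_unique _ _ _ hjl hxy ▸ hlj
      · exact hF.out_unique _ _ _ hc hxy ▸ hcj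
  obtain rfl := hF.eq_of_metaEdge_root hr key
  exact (hF.mem_roots_iff r).1 hr l hjl

variable [DecidableEq V]

/-- A path through the new edge is cut before its first use and after its last. -/
theorem metaEdge_insert_iff :
    MetaEdge (insert (j, l) F) x u ↔ MetaEdge F x u ∨ (MetaEdge F x j ∧ MetaEdge F l u) := by
  constructor
  · intro h
    induction h using Relation.ReflTransGen.head_induction_on with
    | refl => exact Or.inl .refl
    | head hxy _ ih =>
      rcases Finset.mem_insert.1 hxy with h | h
      · obtain ⟨rfl, rfl⟩ := Prod.mk.inj h
        exact Or.inr ⟨.refl, ih.elim id And.right⟩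
      · exact ih.imp (fun h' => .head h h') (fun h' => ⟨.head h h'.1, h'.2⟩)
  · rintro (h | ⟨h, h'⟩)
    · exact h.mono (Finset.subset_insert _ _)
    · exact (h.mono (Finset.subset_insert _ _)).trans
        (.head (Finset.mem_insert_self _ _) (h'.mono (Finset.subset_insert _ _)))

theorem IsRootedForest.insert_edge (hj : j ∉ U) (hG : IsRootedForest G (insert j U))
    (hl : ¬ MetaEdge G l j) : IsRootedForest (insert (j, l) G) U := by
  have hjG : ∀ k, (j, k) ∉ G := (hG.mem_roots_iff j).1 (Finset.mem_insert_self _ _)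
  refine ⟨?_, ?_, ?_⟩
  · intro i k m hk hm
    rw [Finset.mem_insert, Prod.mk.injEq] at hk hm
    rcases hk with ⟨rfl, rfl⟩ | hk <;> rcases hm with ⟨h, rfl⟩ | hm
    · rfl
    · exact absurd hm (hjG _)
    · exact absurd (h ▸ hk) (hjG _)
    · exact hG.out_unique _ _ _ hk hm
  · intro i
    constructor
    · intro hi k hk
      rw [Finset.mem_insert, Prod.mk.injEq] at hk
      rcases hk with ⟨rfl, -⟩ | hk
      · exact hj hi
      · exact (hG.mem_roots_iff i).1 (Finset.mem_insert_of_mem hi) k hk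
    · intro h
      have hi : i ∈ insert j U :=
        (hG.mem_roots_iff i).2 fun k hk => h k (Finset.mem_insert_of_mem hk)
      rcases Finset.mem_insert.1 hi with rfl | hi
      · exact absurd (Finset.mem_insert_self _ _) (h l)
      · exact hi
  · intro x
    obtain ⟨r, hr, hxr⟩ := hG.exists_path_to_root x
    rcases Finset.mem_insert.1 hr with rfl | hr
    · obtain ⟨s, hs, hls⟩ := hG.exists_path_to_root l
      rcases Finset.mem_insert.1 hs with rfl | hs
      · exact absurd hls hl
      · exact ⟨s, hs, metaEdge_insert_iff.2 (Or.inr ⟨hxr, hls⟩)⟩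
    · exact ⟨r, hr, metaEdge_insert_iff.2 (Or.inl hxr)⟩

theorem IsRootedForest.erase_edge (hF : IsRootedForest F U) (hjl : (j, l) ∈ F) :
    IsRootedForest (F.erase (j, l)) (insert j U) := by
  refine ⟨?_, ?_, ?_⟩
  · intro i k m hk hm
    exact hF.out_unique i k m (Finset.mem_of_mem_erase hk) (Finset.mem_of_mem_erase hm)
  · intro i
    rw [Finset.mem_insert, hF.mem_roots_iff]
    constructor
    · rintro (rfl | h) k hk
      · obtain ⟨hne, hk⟩ := Finset.mem_erase.1 hk
        exact hne (by rw [hF.out_unique _ _ _ hk hjl])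
      · exact h k (Finset.mem_of_mem_erase hk)
    · intro h
      by_cases hij : i = j
      · exact Or.inl hij
      · exact Or.inr fun k hk =>
          h k (Finset.mem_erase.2 ⟨fun h' => hij (Prod.mk.inj h').1, hk⟩)
  · intro x
    obtain ⟨r, hr, hxr⟩ := hF.exists_path_to_root x
    rw [← Finset.insert_erase hjl, metaEdge_insert_iff] at hxr
    rcases hxr with h | ⟨h, -⟩
    · exact ⟨r, Finset.mem_insert_of_mem hr, h⟩
    · exact ⟨j, Finset.mem_insert_self _ _, h⟩

end Forests

/-! ### Forest sums, expansion along an out-edge, harmonicity -/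

section Sums

variable {V : Type*} [Fintype V] [DecidableEq V] {R : Type*} {U : Finset V} {j u k : V}

omit [DecidableEq V] in
theorem mem_rootedForests {F : Finset (V × V)} : F ∈ rootedForests U ↔ IsRootedForest F U := by
  simp [rootedForests]

open Classical in
/-- Forests with roots `U` arise from those with an additional root `j` by adding an edge `j → l`,
where `l` is not in the tree of `j`. -/
theorem sum_rootedForests_eq_sum_insert [AddCommMonoid R] (hj : j ∉ U)
    (φ : Finset (V × V) → R) :
    ∑ F ∈ rootedForests U, φ F = ∑ G ∈ rootedForests (insert j U),
      ∑ l with ¬ MetaEdge G l j, φ (insert (j, l) G) := by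
  rw [Finset.sum_sigma']
  symm
  refine Finset.sum_bij (fun p _ => insert (j, p.2) p.1) ?_ ?_ ?_ (fun _ _ => rfl)
  · rintro ⟨G, l⟩ h
    simp only [Finset.mem_sigma, mem_rootedForests, Finset.mem_filter, Finset.mem_univ,
      true_and] at h
    exact mem_rootedForests.2 (h.1.insert_edge hj h.2)
  · rintro ⟨G, l⟩ h ⟨G', l'⟩ h' heq
    simp only [Finset.mem_sigma, mem_rootedForests, Finset.mem_filter, Finset.mem_univ,
      true_and] at h h' heq
    have hG := (h.1.mem_roots_iff j).1 (Finset.mem_insert_self _ _)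
    have hG' := (h'.1.mem_roots_iff j).1 (Finset.mem_insert_self _ _)
    have hl : (j, l) ∈ insert (j, l') G' := heq ▸ Finset.mem_insert_self _ _
    obtain rfl : l = l' := by simpa [hG'] using hl
    rw [← Finset.erase_insert (hG l), heq, Finset.erase_insert (hG' l)]
  · intro F hF
    rw [mem_rootedForests] at hF
    obtain ⟨l, hl⟩ : ∃ l, (j, l) ∈ F := by
      by_contra! h
      exact hj ((hF.mem_roots_iff j).2 h)
    refine ⟨⟨F.erase (j, l), l⟩, ?_, Finset.insert_erase hl⟩
    simp only [Finset.mem_sigma, mem_rootedForests, Finset.mem_filter, Finset.mem_univ, true_and]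
    exact ⟨hF.erase_edge hl,
      fun h => hF.not_metaEdge_of_edge hl (h.mono (Finset.erase_subset _ _))⟩

variable [CommRing R] (a : V → V → R)

/-- The sum of the weights of the forests with set of roots `U`. -/
noncomputable def forestSum (U : Finset V) : R := ∑ F ∈ rootedForests U, weight a F

open Classical in
/-- The sum of the weights of the forests with set of roots `U` and a meta-edge `i → j`. -/
noncomputable def forestSumWithMetaEdge (U : Finset V) (i j : V) : R :=
  ∑ F ∈ rootedForestsWithMetaEdge U i j, weight a F

open Classical in
/-- The indicator of the meta-edge `i → j` in `F`. -/
noncomputable def metaEdgeIndicator (R : Type*) [CommRing R] (F : Finset (V × V)) (i j : V) : R :=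
  if MetaEdge F i j then 1 else 0

omit [DecidableEq V] in
theorem forestSumWithMetaEdge_eq_sum_indicator (i j : V) :
    forestSumWithMetaEdge a U i j =
      ∑ F ∈ rootedForests U, weight a F * metaEdgeIndicator R F i j := by
  simp [forestSumWithMetaEdge, rootedForestsWithMetaEdge, metaEdgeIndicator, Finset.sum_filter]

omit [Fintype V] in
theorem weight_insert_edge {G : Finset (V × V)} (hG : IsRootedForest G (insert j U)) (l : V) :
    weight a (insert (j, l) G) = a j l * weight a G :=
  Finset.prod_insert ((hG.mem_roots_iff j).1 (Finset.mem_insert_self _ _) l)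

/-- The difference counts the forests in which `l` avoids the tree of `j`. It vanishes for `l = j`,
so loop weights play no role. -/
theorem forestSum_eq_sum_insert (hj : j ∉ U) :
    forestSum a U =
      ∑ l, a j l * (forestSum a (insert j U) - forestSumWithMetaEdge a (insert j U) l j) := by
  classical
  simp only [forestSum, forestSumWithMetaEdge_eq_sum_indicator, ← Finset.sum_sub_distrib,
    Finset.mul_sum]
  rw [sum_rootedForests_eq_sum_insert hj, Finset.sum_comm]
  refine Finset.sum_congr rfl fun G hG => ?_
  rw [Finset.sum_filter]
  refine Finset.sum_congr rfl fun l _ => ?_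
  rw [weight_insert_edge a (mem_rootedForests.1 hG)]
  by_cases h : MetaEdge G l j <;> simp [h, metaEdgeIndicator]

theorem forestSumWithMetaEdge_eq_sum_insert (hj : j ∉ U) (hu : u ∈ U) (k : V) :
    forestSumWithMetaEdge a U k u = ∑ G ∈ rootedForests (insert j U), weight a G * ∑ l, a j l *
      ((1 - metaEdgeIndicator R G l j) * metaEdgeIndicator R G k u +
        metaEdgeIndicator R G k j * metaEdgeIndicator R G l u) := by
  classical
  rw [forestSumWithMetaEdge_eq_sum_indicator, sum_rootedForests_eq_sum_insert hj]
  refine Finset.sum_congr rfl fun G hG => ?_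
  rw [mem_rootedForests] at hG
  rw [Finset.sum_filter, Finset.mul_sum]
  refine Finset.sum_congr rfl fun l _ => ?_
  rw [weight_insert_edge a hG]
  -- The roots `j` and `u` differ, so no node leads to both. Hence `l → u` already excludes `l → j`,
  -- and the second summand needs no factor for it.
  have hne : ∀ x, MetaEdge G x j → ¬ MetaEdge G x u := fun x h h' => hj <|
    hG.root_unique (Finset.mem_insert_self _ _) (Finset.mem_insert_of_mem hu) h h' ▸ hu
  have hl := hne l
  have hk := hne k
  simp only [metaEdgeIndicator, metaEdge_insert_iff]
  by_cases h1 : MetaEdge G l j <;> by_cases h2 : MetaEdge G k j <;>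
    by_cases h3 : MetaEdge G l u <;> by_cases h4 : MetaEdge G k u <;>
    simp_all [mul_comm]

theorem forestSumWithMetaEdge_self_eq_sum_insert (hj : j ∉ U) (hu : u ∈ U) :
    forestSumWithMetaEdge a U j u =
      ∑ l, a j l * forestSumWithMetaEdge a (insert j U) l u := by
  classical
  rw [forestSumWithMetaEdge_eq_sum_insert a hj hu]
  simp only [forestSumWithMetaEdge_eq_sum_indicator, Finset.mul_sum]
  rw [Finset.sum_comm]
  refine Finset.sum_congr rfl fun l _ => Finset.sum_congr rfl fun G hG => ?_
  rw [mem_rootedForests] at hG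
  have h1 : ¬ MetaEdge G j u := fun h => hj <|
    hG.eq_of_metaEdge_root (Finset.mem_insert_self _ _) h ▸ hu
  have h2 : MetaEdge G j j := .refl
  simp only [metaEdgeIndicator, h1, h2, if_true, if_false]
  ring

/-- As a function of its source, the sum of the weights of the forests with a meta-edge to the
root `u` is harmonic outside of the roots. -/
theorem forestSumWithMetaEdge_harmonic (hj : j ∉ U) (hu : u ∈ U) :
    ∑ k, a j k * (forestSumWithMetaEdge a U j u - forestSumWithMetaEdge a U k u) = 0 := by
  simp only [mul_sub, Finset.sum_sub_distrib]
  rw [sub_eq_zero, ← Finset.sum_mul, forestSumWithMetaEdge_self_eq_sum_insert a hj hu]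
  simp only [forestSumWithMetaEdge_eq_sum_insert a hj hu,
    forestSumWithMetaEdge_eq_sum_indicator (U := insert j U)]
  simp only [Finset.mul_sum (s := rootedForests (insert j U))]
  rw [Finset.sum_comm, Finset.mul_sum, Finset.sum_comm (s := Finset.univ) (t := rootedForests _)]
  -- For fixed `G`, let `S`, `A`, `B` be the sums of `a j l` over all `l`, over `l → u` and over `l
  -- → j`. Up to the weight of `G`, the claim is `S * A = (S - B) * A + B * A`.
  refine Finset.sum_congr rfl fun G _ => ?_
  have h1 : ∀ k, ∑ l, a j l *
      ((1 - metaEdgeIndicator R G l j) * metaEdgeIndicator R G k u +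
        metaEdgeIndicator R G k j * metaEdgeIndicator R G l u) =
      (∑ l, a j l - ∑ l, a j l * metaEdgeIndicator R G l j) * metaEdgeIndicator R G k u +
        metaEdgeIndicator R G k j * ∑ l, a j l * metaEdgeIndicator R G l u := by
    intro k
    rw [← Finset.sum_sub_distrib, Finset.sum_mul, Finset.mul_sum, ← Finset.sum_add_distrib]
    exact Finset.sum_congr rfl fun l _ => by ring
  simp only [h1]
  have h2 : ∀ S A B : R, ∑ k, a j k * (weight a G * ((S - B) * metaEdgeIndicator R G k u +
      metaEdgeIndicator R G k j * A)) = weight a G *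
      ((S - B) * ∑ k, a j k * metaEdgeIndicator R G k u +
        (∑ k, a j k * metaEdgeIndicator R G k j) * A) := by
    intro S A B
    rw [Finset.sum_mul, Finset.mul_sum, ← Finset.sum_add_distrib, Finset.mul_sum]
    exact Finset.sum_congr rfl fun k _ => by ring
  have h3 : ∑ l, a j l * (weight a G * metaEdgeIndicator R G l u) =
      weight a G * ∑ l, a j l * metaEdgeIndicator R G l u := by
    rw [Finset.mul_sum]
    exact Finset.sum_congr rfl fun k _ => by ring
  rw [h2, h3]
  ring

omit [DecidableEq V] in
theorem forestSumWithMetaEdge_refl (u : V) :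
    forestSumWithMetaEdge a U u u = forestSum a U := by
  have h : ∀ F : Finset (V × V), MetaEdge F u u := fun _ => .refl
  simp [forestSumWithMetaEdge_eq_sum_indicator, forestSum, metaEdgeIndicator, h]

omit [DecidableEq V] in
theorem forestSumWithMetaEdge_root (hj : j ∈ U) (h : j ≠ k) :
    forestSumWithMetaEdge a U j k = 0 := by
  rw [forestSumWithMetaEdge_eq_sum_indicator]
  refine Finset.sum_eq_zero fun F hF => ?_
  have : ¬ MetaEdge F j k := fun h' => h ((mem_rootedForests.1 hF).eq_of_metaEdge_root hj h')
  simp [metaEdgeIndicator, this]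

end Sums

/-! ### Maximum principle and the identity for positive real weights -/

section Positive

variable {V : Type*} [Fintype V] [DecidableEq V]

/-- At a maximum off `U`, a sum of nonnegative terms vanishes; since all weights are positive, the
maximum equals the value at any chosen `r ∈ U`. -/
theorem nonpos_of_harmonic {a : V → V → ℝ} (ha : ∀ i j, 0 < a i j) {U : Finset V}
    (hU : U.Nonempty) {f : V → ℝ} (hf : ∀ i ∈ U, f i = 0)
    (hharm : ∀ j ∉ U, ∑ k, a j k * (f j - f k) = 0) (i : V) : f i ≤ 0 := by
  obtain ⟨r, hr⟩ := hU
  obtain ⟨j, -, hj⟩ := Finset.exists_max_image Finset.univ f ⟨r, Finset.mem_univ r⟩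
  refine (hj i (Finset.mem_univ i)).trans ?_
  by_cases hjU : j ∈ U
  · exact (hf j hjU).le
  · have h := (Finset.sum_eq_zero_iff_of_nonneg fun k _ =>
      mul_nonneg (ha j k).le (sub_nonneg.2 (hj k (Finset.mem_univ k)))).1 (hharm j hjU) r
      (Finset.mem_univ r)
    rcases mul_eq_zero.1 h with h | h
    · exact absurd h (ha j r).ne'
    · rw [hf r hr] at h
      linarith

theorem eq_zero_of_harmonic {a : V → V → ℝ} (ha : ∀ i j, 0 < a i j) {U : Finset V}
    (hU : U.Nonempty) {f : V → ℝ} (hf : ∀ i ∈ U, f i = 0)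
    (hharm : ∀ j ∉ U, ∑ k, a j k * (f j - f k) = 0) (i : V) : f i = 0 := by
  refine le_antisymm (nonpos_of_harmonic ha hU hf hharm i) ?_
  have := nonpos_of_harmonic ha hU (f := fun i => -f i) (fun i hi => by simp [hf i hi])
    (fun j hj => by
      rw [← neg_eq_zero, ← Finset.sum_neg_distrib, ← hharm j hj]
      exact Finset.sum_congr rfl fun k _ => by ring) i
  linarith

/-- The analogue for forests of the strong Markov property. -/
theorem forestSumWithMetaEdge_mul_forestSum {a : V → V → ℝ} (ha : ∀ i j, 0 < a i j) {r s t : V}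
    (hrs : r ≠ s) (hrt : r ≠ t) (hst : s ≠ t) (j : V) :
    forestSumWithMetaEdge a {r, s} j s * forestSum a {r, s, t} =
      forestSumWithMetaEdge a {r, s, t} j s * forestSum a {r, s} +
        forestSumWithMetaEdge a {r, s, t} j t * forestSumWithMetaEdge a {r, s} t s := by
  rw [← sub_eq_zero]
  refine eq_zero_of_harmonic ha (U := {r, s, t}) ⟨r, by simp⟩
    (f := fun j => forestSumWithMetaEdge a {r, s} j s * forestSum a {r, s, t} -
      (forestSumWithMetaEdge a {r, s, t} j s * forestSum a {r, s} +
        forestSumWithMetaEdge a {r, s, t} j t * forestSumWithMetaEdge a {r, s} t s)) ?_ ?_ j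
  · intro i hi
    simp only [Finset.mem_insert, Finset.mem_singleton] at hi
    rcases hi with rfl | rfl | rfl
    · rw [forestSumWithMetaEdge_root a (by simp) hrs, forestSumWithMetaEdge_root a (by simp) hrs,
        forestSumWithMetaEdge_root a (by simp) hrt]
      ring
    · rw [forestSumWithMetaEdge_refl, forestSumWithMetaEdge_refl,
        forestSumWithMetaEdge_root a (by simp) hst]
      ring
    · rw [forestSumWithMetaEdge_refl,
        forestSumWithMetaEdge_root a (U := {r, s, i}) (by simp) hst.symm]
      ring
  · intro i hi
    have h1 := forestSumWithMetaEdge_harmonic a (U := {r, s}) (j := i) (u := s)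
      (by simp_all) (by simp)
    have h2 := forestSumWithMetaEdge_harmonic a hi (u := s) (by simp)
    have h3 := forestSumWithMetaEdge_harmonic a hi (u := t) (by simp)
    -- The function is a combination of three harmonic ones with coefficients independent of the
    -- node; the right-hand zero is rewritten as the same combination of their vanishing sums.
    rw [← sub_self (0 : ℝ)]
    nth_rewrite 1 [← zero_mul (forestSum a {r, s, t})]
    nth_rewrite 1 [← h1]
    rw [← add_zero (0 : ℝ)]
    nth_rewrite 1 [← zero_mul (forestSum a {r, s})]
    nth_rewrite 1 [← h2]
    nth_rewrite 1 [← zero_mul (forestSumWithMetaEdge a {r, s} t s)]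
    nth_rewrite 1 [← h3]
    rw [Finset.sum_mul, Finset.sum_mul, Finset.sum_mul, ← Finset.sum_add_distrib,
      ← Finset.sum_sub_distrib]
    exact Finset.sum_congr rfl fun k _ => by ring

/-- In each product, the factor in which `s` is not a root is expanded along the out-edge `s → j`.
After cancellation, the coefficient of `a s j` is the Markov identity at `j`. -/
theorem forestSum_mul_forestSum {a : V → V → ℝ} (ha : ∀ i j, 0 < a i j) {r s t : V}
    (hrs : r ≠ s) (hrt : r ≠ t) (hst : s ≠ t) :
    forestSum a {r} * forestSum a {r, s, t} =
      forestSum a {r, t} * forestSum a {r, s} -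
        forestSumWithMetaEdge a {r, t} s t * forestSumWithMetaEdge a {r, s} t s := by
  have e1 : insert s ({r} : Finset V) = {r, s} := Finset.insert_comm s r ∅
  have e2 : insert s ({r, t} : Finset V) = {r, s, t} := Finset.insert_comm s r {t}
  rw [forestSum_eq_sum_insert a (j := s) (U := {r}) (by simpa using hrs.symm),
    forestSum_eq_sum_insert a (j := s) (U := {r, t}) (by simp [hrs.symm, hst]),
    forestSumWithMetaEdge_self_eq_sum_insert a (j := s) (U := {r, t}) (u := t)
      (by simp [hrs.symm, hst]) (by simp), e1, e2, Finset.sum_mul, Finset.sum_mul, Finset.sum_mul,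
      ← Finset.sum_sub_distrib]
  refine Finset.sum_congr rfl fun j _ => ?_
  linear_combination (-a s j) * forestSumWithMetaEdge_mul_forestSum ha hrs hrt hst j

end Positive

/-! ### Transfer to arbitrary commutative semirings -/

theorem sum_product_weight {V R : Type*} [CommSemiring R] (a : V → V → R)
    (s t : Finset (Finset (V × V))) :
    ∑ p ∈ s ×ˢ t, weight a p.1 * weight a p.2 = (∑ F ∈ s, weight a F) * ∑ G ∈ t, weight a G := by
  rw [Finset.sum_product, Finset.sum_mul_sum]

theorem sum_weight_eq_sum_nonForbiddenPairs_of_pos {n : ℕ} (hn : 2 ≤ n)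
    {a : Fin (n + 1) → Fin (n + 1) → ℝ} (ha : ∀ i j, 0 < a i j) :
    ∑ p ∈ rootedForests {0} ×ˢ rootedForests {0, 1, 2}, weight a p.1 * weight a p.2 =
      ∑ p ∈ nonForbiddenPairs n, weight a p.1 * weight a p.2 := by
  obtain ⟨m, rfl⟩ := Nat.exists_eq_add_of_le' hn
  have h2 : ((2 : Fin (m + 2 + 1)) : ℕ) = 2 := Fin.val_two
  have h := forestSum_mul_forestSum ha (r := 0) (s := 1) (t := 2)
    (by simp) (by rw [Ne, Fin.ext_iff, h2]; simp) (by rw [Ne, Fin.ext_iff, h2]; simp)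
  have hsub : rootedForestsWithMetaEdge (V := Fin (m + 2 + 1)) {0, 2} 1 2 ×ˢ
      rootedForestsWithMetaEdge (V := Fin (m + 2 + 1)) {0, 1} 2 1 ⊆
      rootedForests {0, 2} ×ˢ rootedForests {0, 1} := by
    classical
    exact Finset.product_subset_product (Finset.filter_subset _ _) (Finset.filter_subset _ _)
  have h' := Finset.sum_sdiff (f := fun p => weight a p.1 * weight a p.2) hsub
  rw [sum_product_weight, sum_product_weight] at h'
  rw [sum_product_weight]
  simp only [forestSum, forestSumWithMetaEdge] at h
  rw [h, ← h', nonForbiddenPairs, add_sub_cancel_right]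

theorem map_weight {V R S : Type*} [CommSemiring R] [CommSemiring S] (φ : R →+* S)
    (a : V → V → R) (F : Finset (V × V)) :
    φ (weight a F) = weight (fun i j => φ (a i j)) F := by
  simp [weight, map_prod]

end ForestIdentity

open ForestIdentity MvPolynomial in
theorem ForestIdentity.sum_weight_X_eq {n : ℕ} (hn : 2 ≤ n) :
    ∑ p ∈ rootedForests {0} ×ˢ rootedForests {0, 1, 2},
      weight (fun i j : Fin (n + 1) => (X (i, j) : MvPolynomial _ ℕ)) p.1 *
        weight (fun i j => X (i, j)) p.2 =
      ∑ p ∈ nonForbiddenPairs n,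
        weight (fun i j => X (i, j)) p.1 * weight (fun i j => X (i, j)) p.2 := by
  apply MvPolynomial.map_injective (Nat.castRingHom ℝ) Nat.cast_injective
  -- A real polynomial is determined by its values on a product of infinite sets, here the positive
  -- orthant.
  refine MvPolynomial.funext_set (fun _ => Set.Ioi 0) (fun _ => Set.Ioi_infinite 0) fun x hx => ?_
  simp only [map_sum, map_mul, map_weight, map_X, eval_X]
  exact sum_weight_eq_sum_nonForbiddenPairs_of_pos hn fun i j => hx (i, j) (Set.mem_univ _)

theorem mainTheorem1 {R : Type*} [CommSemiring R] (n : ℕ) (hn : 2 ≤ n)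
    (a : Fin (n + 1) → Fin (n + 1) → R) :
    ∑ p ∈ ForestIdentity.rootedForests {0} ×ˢ ForestIdentity.rootedForests {0, 1, 2},
        ForestIdentity.weight a p.1 * ForestIdentity.weight a p.2 =
      ∑ p ∈ ForestIdentity.nonForbiddenPairs n,
        ForestIdentity.weight a p.1 * ForestIdentity.weight a p.2 := by
  have h := congrArg (MvPolynomial.eval₂Hom (Nat.castRingHom R) fun e => a e.1 e.2)
    (ForestIdentity.sum_weight_X_eq hn)
  simpa only [map_sum, map_mul, ForestIdentity.map_weight, MvPolynomial.eval₂Hom_X'] using h
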